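/- Let $M$ be a smooth manifold of dimension $n$ (without boundary), let $J\subseteq\mathbb{R}$ be an interval, and let $(g_t)_{t\in J}$ be a Ricci flow on $M$, that is, a family of smooth Riemannian metrics on $M$, smooth in $(t,x)\in J\times M$, such that $$\partial_t g_t=-2\,\mathrm{Ric}(g_t)\qquad\text{on } M \text{ for all } t\in J$$ (with one-sided time derivatives at those endpoints of $J$ that belong to $J$). Here $R(X,Y)Z=\nabla_X\nabla_YZ-\nabla_Y\nabla_XZ-\nabla_{[X,Y]}Z$ is the curvature of the Levi-Civita connection $\nabla$ of the metric, $\mathrm{Ric}(Y,Z)=\operatorname{tr}(X\mapsto R(X,Y)Z)$, and $K(X,Y)=\langle R(X,Y)Y,X\rangle$ is the sectional curvature of the plane spanned by orthonormal tangent vectors $X,Y$. Suppose that all sectional curvatures of $g_t$ are non-negative, for every $t\in J$. For $x,y\in M$ let $d_t(x,y)\in[0,\infty]$ be the Riemannian distance of $g_t$, that is, the infimum of the $g_t$-lengths of the $C^1$ paths in $M$ from $x$ to $y$ (equal to $\infty$ if there is no such path). Then for all fixed $x,y\in M$ the function $t\mapsto d_t(x,y)$ is non-increasing on $J$: if $s,t\in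 J$ and $s\le t$, then $d_t(x,y)\le d_s(x,y)$. -/

import Mathlib

open Set Bundle Manifold
open scoped Manifold ContDiff Topology ENNReal

noncomputable section

namespace RicciFlow

/-- The model space of an `n`-dimensional manifold. -/
abbrev Model (n : ℕ) : Type := EuclideanSpace ℝ (Fin n)

/-- A smooth Riemannian metric on the smooth `n`-manifold `M`. -/
abbrev Metric (n : ℕ) (M : Type*) [TopologicalSpace M] [ChartedSpace (Model n) M]
    [IsManifold (𝓡 n) ∞ M] : Type _ :=
  ContMDiffRiemannianMetric (𝓡 n) ∞ (Model n) (fun x : M ↦ TangentSpace (𝓡 n) x)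

/-- The `i`-th standard basis vector of `ℝⁿ`. -/
def stdVec {n : ℕ} (i : Fin n) : Model n := EuclideanSpace.single i 1

/-- The partial derivative `∂ᵢ f` at `u`. -/
def partialDeriv {n : ℕ} (i : Fin n) (f : Model n → ℝ) (u : Model n) : ℝ :=
  fderiv ℝ f u (stdVec i)

section

variable {n : ℕ} {M : Type*} [TopologicalSpace M] [ChartedSpace (Model n) M]
  [IsManifold (𝓡 n) ∞ M]

/-- The coordinate vector field `∂ᵢ` of the preferred chart at `x`, at the point of `M` with
coordinates `u`. -/
def coordField (x : M) (i : Fin n) (u : Model n) :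
    TangentSpace (𝓡 n) ((extChartAt (𝓡 n) x).symm u) :=
  mfderiv 𝓘(ℝ, Model n) (𝓡 n) (extChartAt (𝓡 n) x).symm u (stdVec i)

/-- The components `g_{ij}` of the metric in the preferred chart at `x`, as functions of the
coordinates `u` (meaningful for `u` in the target of the chart, an open set). -/
def metricCoeff (g : Metric n M) (x : M) (u : Model n) : Matrix (Fin n) (Fin n) ℝ :=
  Matrix.of fun i j ↦
    g.inner ((extChartAt (𝓡 n) x).symm u) (coordField x i u) (coordField x j u)

/-- The Christoffel symbol `Γᵃ_{bc}` of the Levi-Civita connection in the preferred chart at `x`: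
`Γᵃ_{bc} = ½ gᵃᵈ (∂_b g_{cd} + ∂_c g_{bd} - ∂_d g_{bc})`. -/
def christoffel (g : Metric n M) (x : M) (a b c : Fin n) (u : Model n) : ℝ :=
  (1 / 2) * ∑ d, (metricCoeff g x u)⁻¹ a d *
    (partialDeriv b (fun w ↦ metricCoeff g x w c d) u
      + partialDeriv c (fun w ↦ metricCoeff g x w b d) u
      - partialDeriv d (fun w ↦ metricCoeff g x w b c) u)

/-- The components of the Riemann curvature tensor in the preferred chart at `x`, where
`R(∂_a, ∂_b) ∂_c = ∇_a ∇_b ∂_c - ∇_b ∇_a ∂_c = ∑_d riemannCoeff a b c d • ∂_d`. -/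
def riemannCoeff (g : Metric n M) (x : M) (a b c d : Fin n) (u : Model n) : ℝ :=
  partialDeriv a (christoffel g x d b c) u - partialDeriv b (christoffel g x d a c) u
    + ∑ s, (christoffel g x s b c u * christoffel g x d a s u
      - christoffel g x s a c u * christoffel g x d b s u)

/-- The components of a tangent vector at `x` in the preferred chart at `x`. In Mathlib,
`TangentSpace (𝓡 n) x` is `ℝⁿ`, identified with the tangent space through that chart. -/
def component {x : M} (v : TangentSpace (𝓡 n) x) (i : Fin n) : ℝ :=
  (show Model n from v) i

/-- The tangent vector at `x` with given components in the preferred chart at `x`. -/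
def ofComponents (x : M) (c : Fin n → ℝ) : TangentSpace (𝓡 n) x :=
  show Model n from WithLp.toLp 2 c

/-- The Riemann curvature `R(X, Y) Z` at the point `x`. -/
def riemann (g : Metric n M) (x : M) (X Y Z : TangentSpace (𝓡 n) x) : TangentSpace (𝓡 n) x :=
  ofComponents x fun d ↦ ∑ a, ∑ b, ∑ c,
    riemannCoeff g x a b c d (extChartAt (𝓡 n) x x) * component X a * component Y b * component Z c

/-- The Ricci curvature `Ric(Y, Z)` at `x`: the trace of `X ↦ R(X, Y) Z`. -/
def ricci (g : Metric n M) (x : M) (Y Z : TangentSpace (𝓡 n) x) : ℝ :=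
  ∑ b, ∑ c, (∑ a, riemannCoeff g x a b c a (extChartAt (𝓡 n) x x)) * component Y b * component Z c

/-- The sectional curvature `K(X, Y) = ⟨R(X, Y) Y, X⟩` of the plane spanned by two orthonormal
tangent vectors `X`, `Y` at `x`. -/
def sectionalCurvature (g : Metric n M) (x : M) (X Y : TangentSpace (𝓡 n) x) : ℝ :=
  g.inner x (riemann g x X Y Y) X

/-- All sectional curvatures of `g` are non-negative. -/
def NonnegSectionalCurvature (g : Metric n M) : Prop :=
  ∀ (x : M) (X Y : TangentSpace (𝓡 n) x),
    g.inner x X X = 1 → g.inner x Y Y = 1 → g.inner x X Y = 0 → 0 ≤ sectionalCurvature g x X Y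

/-- The Riemannian distance of `g`: the infimum of the `g`-lengths of the `C¹` paths from `x` to
`y` (it is `∞` exactly when there is no such path). -/
def riemannianDist (g : Metric n M) (x y : M) : ℝ≥0∞ :=
  letI : RiemannianBundle (fun x : M ↦ TangentSpace (𝓡 n) x) := ⟨g.toRiemannianMetric⟩
  Manifold.riemannianEDist (𝓡 n) x y

/-- `g` is a Ricci flow on `M` over the time interval `J`: a smooth family of smooth Riemannian
metrics `g t`, `t ∈ J`, with `∂ₜ g = -2 Ric` (with one-sided derivatives at those endpoints of `J`
that belong to `J`). The values `g t` with `t ∉ J` play no role. -/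
structure IsRicciFlow (g : ℝ → Metric n M) (J : Set ℝ) : Prop where
  interval : J.OrdConnected
  smooth : ContMDiffOn (𝓘(ℝ, ℝ).prod (𝓡 n))
    ((𝓡 n).prod 𝓘(ℝ, Model n →L[ℝ] Model n →L[ℝ] ℝ)) ∞
    (fun p : ℝ × M ↦ TotalSpace.mk' (Model n →L[ℝ] Model n →L[ℝ] ℝ)
      (E := fun x : M ↦ TangentSpace (𝓡 n) x →L[ℝ] TangentSpace (𝓡 n) x →L[ℝ] ℝ)
      p.2 ((g p.1).inner p.2)) (J ×ˢ univ)
  evolution : ∀ t ∈ J, ∀ (x : M) (X Y : TangentSpace (𝓡 n) x),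
    HasDerivWithinAt (fun s ↦ (g s).inner x X Y) (-2 * ricci (g t) x X Y) J t

end

end RicciFlow

end

/-! For a `g`-unit vector `Y`, compute the trace of `X ↦ R(X, Y) Y` in a `g`-orthonormal basis
containing `Y`: the `Y` term vanishes and the others are sectional curvatures, so `Ric(Y, Y) ≥ 0`
(`NonnegSectionalCurvature.ricci_nonneg`). The flow equation then makes `g_t(X, X)` non-increasing
for each fixed `X`. Hence every fixed path gets no longer, and so does the infimum over paths; no
minimizing geodesics or completeness are needed. -/

/-- The trace of an endomorphism of a finite-dimensional inner product space is non-negative if its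
quadratic form vanishes at a unit vector `y` and is non-negative at the unit vectors orthogonal
to `y`. -/
theorem LinearMap.trace_nonneg_of_core {V : Type*} [AddCommGroup V] [Module ℝ V]
    [FiniteDimensional ℝ V] (c : InnerProductSpace.Core ℝ V) (L : V →ₗ[ℝ] V) {y : V}
    (hy : c.inner y y = 1) (hL : L y = 0)
    (h : ∀ v : V, c.inner v v = 1 → c.inner v y = 0 → 0 ≤ c.inner (L v) v) :
    0 ≤ LinearMap.trace ℝ V L := by
  -- The norm comes from `c`, so that a tangent space can be given the metric of the flow instead of
  -- its Euclidean model norm.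
  let : NormedAddCommGroup V := c.toNormedAddCommGroup
  let : InnerProductSpace ℝ V := InnerProductSpace.ofCore c.toCore
  have hn : ‖y‖ = 1 := by
    have : inner ℝ y y = 1 := hy
    rw [real_inner_self_eq_norm_sq] at this
    exact (pow_eq_one_iff_of_nonneg (norm_nonneg y) two_ne_zero).1 this
  have ho : Orthonormal ℝ ((↑) : ({y} : Set V) → V) := by
    refine ⟨fun ⟨z, hz⟩ ↦ ?_, fun ⟨z, hz⟩ ⟨w, hw⟩ hne ↦ ?_⟩
    · rw [Set.mem_singleton_iff] at hz
      simpa [hz] using hn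
    · exact absurd (Subtype.ext ((Set.mem_singleton_iff.1 hz).trans
        (Set.mem_singleton_iff.1 hw).symm)) hne
  obtain ⟨u, b, hu, hb⟩ := ho.exists_orthonormalBasis_extension
  have hyu : y ∈ u := hu rfl
  rw [LinearMap.trace_eq_sum_inner L b]
  refine Finset.sum_nonneg fun i _ ↦ ?_
  rw [real_inner_comm]
  by_cases hi : (i : V) = y
  · simp [hb, hi, hL]
  · refine h (b i) ?_ ?_
    · exact (real_inner_self_eq_norm_sq (b i)).trans (by simp [b.norm_eq_one])
    · have := b.inner_eq_zero (i := i) (j := ⟨y, hyu⟩) (fun e ↦ hi (by rw [e]))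
      rw [show b ⟨y, hyu⟩ = y by rw [hb]] at this
      exact this

namespace RicciFlow

variable {n : ℕ} {M : Type*} [TopologicalSpace M] [ChartedSpace (Model n) M]

theorem component_add {x : M} (v w : TangentSpace (𝓡 n) x) (i : Fin n) :
    component (v + w) i = component v i + component w i := rfl

theorem component_smul {x : M} (c : ℝ) (v : TangentSpace (𝓡 n) x) (i : Fin n) :
    component (c • v) i = c * component v i := rfl

theorem component_ext {x : M} {v w : TangentSpace (𝓡 n) x}
    (h : ∀ i, component v i = component w i) : v = w :=
  PiLp.ext (α := fun _ : Fin n ↦ ℝ) h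

variable [IsManifold (𝓡 n) ∞ M]

theorem ricci_smul_smul (g : Metric n M) (x : M) (c : ℝ) (Y : TangentSpace (𝓡 n) x) :
    ricci g x (c • Y) (c • Y) = c ^ 2 * ricci g x Y Y := by
  simp only [ricci, component_smul, Finset.mul_sum]
  exact Finset.sum_congr rfl fun _ _ ↦ Finset.sum_congr rfl fun _ _ ↦ by ring

theorem riemannCoeff_swap (g : Metric n M) (x : M) (a b c d : Fin n) (u : Model n) :
    riemannCoeff g x b a c d u = -riemannCoeff g x a b c d u := by
  simp only [riemannCoeff, Finset.sum_sub_distrib]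
  ring

theorem component_riemann (g : Metric n M) (x : M) (X Y Z : TangentSpace (𝓡 n) x) (d : Fin n) :
    component (riemann g x X Y Z) d = ∑ a, ∑ b, ∑ c, riemannCoeff g x a b c d
      (extChartAt (𝓡 n) x x) * component X a * component Y b * component Z c := rfl

/-- The coefficients are antisymmetric in their first two indices, so contracting these with `Y`,
`Y` gives a sum equal to its own negative. -/
theorem riemann_self (g : Metric n M) (x : M) (Y Z : TangentSpace (𝓡 n) x) :
    riemann g x Y Y Z = 0 := by
  refine component_ext fun d ↦ ?_
  change component (riemann g x Y Y Z) d = 0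
  rw [component_riemann, ← self_eq_neg]
  conv_lhs => rw [Finset.sum_comm]
  simp only [← Finset.sum_neg_distrib]
  refine Finset.sum_congr rfl fun a _ ↦ Finset.sum_congr rfl fun b _ ↦
    Finset.sum_congr rfl fun c _ ↦ ?_
  rw [riemannCoeff_swap]
  ring

/-- The endomorphism `X ↦ R(X, Y) Z` of the tangent space. -/
noncomputable def riemannEnd (g : Metric n M) (x : M) (Y Z : TangentSpace (𝓡 n) x) :
    TangentSpace (𝓡 n) x →ₗ[ℝ] TangentSpace (𝓡 n) x where
  toFun X := riemann g x X Y Z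
  map_add' X X' := component_ext fun d ↦ by
    simp only [component_add, component_riemann, mul_add, add_mul, Finset.sum_add_distrib]
  map_smul' r X := component_ext fun d ↦ by
    simp only [component_smul, component_riemann, Finset.mul_sum, RingHom.id_apply]
    exact Finset.sum_congr rfl fun _ _ ↦ Finset.sum_congr rfl fun _ _ ↦
      Finset.sum_congr rfl fun _ _ ↦ by ring

/-- Links the coordinate formula for Ricci to a basis-free trace, which may then be computed in a
`g`-orthonormal basis. -/
theorem trace_riemannEnd (g : Metric n M) (x : M) (Y Z : TangentSpace (𝓡 n) x) :
    LinearMap.trace ℝ (TangentSpace (𝓡 n) x) (riemannEnd g x Y Z) = ricci g x Y Z := by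
  let L : Model n →ₗ[ℝ] Model n := riemannEnd g x Y Z
  change LinearMap.trace ℝ (Model n) L = _
  rw [LinearMap.trace_eq_matrix_trace ℝ (EuclideanSpace.basisFun (Fin n) ℝ).toBasis, Matrix.trace]
  have key : ∀ a, (LinearMap.toMatrix (EuclideanSpace.basisFun (Fin n) ℝ).toBasis
      (EuclideanSpace.basisFun (Fin n) ℝ).toBasis L).diag a =
      ∑ b, ∑ c, riemannCoeff g x a b c a (extChartAt (𝓡 n) x x) * component Y b
        * component Z c := by
    intro a
    rw [Matrix.diag_apply, LinearMap.toMatrix_apply, OrthonormalBasis.coe_toBasis_repr_apply,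
      EuclideanSpace.basisFun_repr, OrthonormalBasis.coe_toBasis, EuclideanSpace.basisFun_apply]
    change (∑ a', ∑ b, ∑ c, riemannCoeff g x a' b c a (extChartAt (𝓡 n) x x)
      * (EuclideanSpace.single a (1 : ℝ) : Model n) a' * component Y b * component Z c) = _
    rw [Finset.sum_eq_single a]
    · simp
    · intro a' _ ha'
      simp [ha']
    · simp
  simp only [key, ricci, Finset.sum_mul]
  rw [Finset.sum_comm]
  exact Finset.sum_congr rfl fun b _ ↦ Finset.sum_comm

theorem NonnegSectionalCurvature.ricci_nonneg {g : Metric n M} (hg : NonnegSectionalCurvature g)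
    (x : M) (Y : TangentSpace (𝓡 n) x) : 0 ≤ ricci g x Y Y := by
  have unit : ∀ Y : TangentSpace (𝓡 n) x, g.inner x Y Y = 1 → 0 ≤ ricci g x Y Y := by
    intro Y hY
    have : FiniteDimensional ℝ (TangentSpace (𝓡 n) x) :=
      inferInstanceAs (FiniteDimensional ℝ (Model n))
    rw [← trace_riemannEnd]
    exact LinearMap.trace_nonneg_of_core (g.toRiemannianMetric.toCore x) _ hY
      (riemann_self g x Y Y) fun v hv hvY ↦ hg x v Y hv hY hvY
  -- Nonzero vectors reduce to unit ones, as Ricci is quadratic in `Y`.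
  by_cases hY : Y = 0
  · have : ricci g x Y Y = 0 := by
      simpa [hY] using ricci_smul_smul g x 0 Y
    exact this.ge
  have hpos := g.pos x Y hY
  set r := √(g.inner x Y Y) with hr
  have hr0 : 0 < r := Real.sqrt_pos.2 hpos
  have hr2 : g.inner x Y Y = r ^ 2 := (Real.sq_sqrt hpos.le).symm
  have h1 : g.inner x (r⁻¹ • Y) (r⁻¹ • Y) = 1 := by
    simp only [map_smul, smul_apply, smul_eq_mul, hr2]
    field_simp
  have h2 := unit _ h1
  rw [ricci_smul_smul] at h2
  exact nonneg_of_mul_nonneg_right h2 (by positivity)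

/-- Under a Ricci flow with non-negative sectional curvatures, tangent vectors get shorter. -/
theorem IsRicciFlow.antitoneOn_inner_self {g : ℝ → Metric n M} {J : Set ℝ} (hg : IsRicciFlow g J)
    (hK : ∀ t ∈ J, NonnegSectionalCurvature (g t)) (x : M) (X : TangentSpace (𝓡 n) x) :
    AntitoneOn (fun t ↦ (g t).inner x X X) J := by
  refine antitoneOn_of_hasDerivWithinAt_nonpos hg.interval.convex
    (fun t ht ↦ (hg.evolution t ht x X X).continuousWithinAt)
    (fun t ht ↦ (hg.evolution t (interior_subset ht) x X X).mono interior_subset) fun t ht ↦ ?_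
  linarith [(hK t (interior_subset ht)).ricci_nonneg x X]

/-- The Riemannian distance is monotone in the metric. -/
theorem riemannianDist_mono {g h : Metric n M}
    (hgh : ∀ (x : M) (X : TangentSpace (𝓡 n) x), g.inner x X X ≤ h.inner x X X) (x y : M) :
    riemannianDist g x y ≤ riemannianDist h x y := by
  unfold riemannianDist
  simp only [Manifold.riemannianEDist]
  -- The admissible paths do not depend on the metric, so speeds are compared pointwise along each
  -- one.
  refine iInf₂_mono fun γ _ ↦ MeasureTheory.lintegral_mono fun t ↦ ?_
  refine ENNReal.coe_le_coe.2 (NNReal.coe_le_coe.1 ?_)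
  exact Real.sqrt_le_sqrt (hgh _ _)

end RicciFlow

theorem proposition6p1 {n : ℕ} {M : Type*} [TopologicalSpace M]
    [ChartedSpace (EuclideanSpace ℝ (Fin n)) M] [IsManifold (𝓡 n) ∞ M]
    (g : ℝ → RicciFlow.Metric n M) (J : Set ℝ) (hg : RicciFlow.IsRicciFlow g J)
    (hK : ∀ t ∈ J, RicciFlow.NonnegSectionalCurvature (g t)) (x y : M) :
    AntitoneOn (fun t ↦ RicciFlow.riemannianDist (g t) x y) J :=
  fun _ hs _ ht hst ↦ RicciFlow.riemannianDist_mono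
    (fun z X ↦ hg.antitoneOn_inner_self hK z X hs ht hst) x y
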